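/- **No–fast-forwarding theorem for Lindbladians.** For a $D\times D$ matrix $L$ (a Lindblad operator on $\mathbb{C}^D$) let $$\mathcal{L}_L(\rho)=L\rho L^\dagger-\tfrac12\big(L^\dagger L\rho+\rho L^\dagger L\big)$$ be the Lindbladian generated by $L$, and let $A_{(k,l),(k',l')}=\tfrac12 L_{k,l}\overline{L_{k',l'}}$ be its (overcomplete) GKS matrix, so that $$\mathcal{L}_L(\rho)=\sum_{k,l,k',l'}A_{(k,l),(k',l')}\big(2\langle l|\rho|l'\rangle|k\rangle\langle k'|-\delta_{kk'}|l'\rangle\langle l|\rho-\delta_{kk'}\rho|l'\rangle\langle l|\big).$$ The diamond norm of a superoperator is $\|\Phi\|_\diamond=\max_{\|X\|_1=1}\|(\Phi\otimes\mathcal{I}_D)(X)\|_1$. A quantum query algorithm with $T$ queries to a black box $f$ with $b$-bit answers acts on the system register together with finitely many ancillas (a query register, a $b$-bit answer register and a workspace of arbitrary finite dimension) prepared in a fixed basis state; it applies $U_T O_f U_{T-1}O_f\cdots O_f U_0$, where the $U_i$ are arbitrary unitaries not depending on $f$ and $O_f|s,q,y,z\rangle=|s,q,y\oplus f(q),z\rangle$,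 and finally discards the ancillas. It thereby implements a quantum operation $\mathcal{E}_f$ on the system; it simulates $\mathcal{L}$ for time $t$ within precision $\epsilon$ if $\|\mathcal{E}_f-e^{t\mathcal{L}}\|_\diamond\le\epsilon$. For every integer $N\ge 7$ there is a nonempty family $\mathcal{F}$ of Lindblad operators on $\mathbb{C}^{N+1}\otimes\mathbb{C}^2$, each of them 1-sparse (at most one nonzero element in each row and in each column) and satisfying $\|\mathcal{L}_L\|_\diamond=1$, such that the following two statements hold, for every number $b$ of answer bits and every fixed encoding of the answers as $b$-bit strings. 1. Every quantum query algorithm that, for each $L\in\mathcal{F}$, simulates $\mathcal{L}_L$ for time $t=4N$ within precision $1/8$ when given the black box that takes a row index and a column index of the GKS matrix $A$ of $\mathcal{L}_L$ and outputs the corresponding entry of $A$, makes at least $N/4=t/16$ queries. 2. Every quantum query algorithm that, for each $L\in\mathcal{F}$, simulates $\mathcal{L}_L$ for time $t=4N$ within precision $1/8$ when given the black box that takes a row index or a column index of $L$ and outputs the locations and values of all nonzero elements of that row or column, makes at least $N/2=t/8$ queries. Equivalently, every algorithm with fewer queries fails to simulate $\mathcal{L}_L$ for time $4N$ within precision $1/8$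 for some $L\in\mathcal{F}$. -/

import Mathlib

open Matrix
open scoped Kronecker ENNReal ComplexOrder

/-! ### Superoperators, Lindbladians, the diamond norm -/

/-- Superoperators: linear maps on the operators on `ℂ^D` (matrices in the computational basis
indexed by `D`). -/
abbrev Superop (D : Type) : Type := Matrix D D ℂ →ₗ[ℂ] Matrix D D ℂ

/-- The Lindbladian generated by the single Lindblad operator `L` (and zero Hamiltonian):
`ρ ↦ L ρ L† - (L† L ρ + ρ L† L) / 2`. -/
noncomputable def lindbladian {D : Type} [Fintype D] (L : Matrix D D ℂ) : Superop D where
  toFun ρ := L * ρ * Lᴴ - (1 / 2 : ℂ) • (Lᴴ * L * ρ + ρ * (Lᴴ * L))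
  map_add' x y := by
    simp only [mul_add, add_mul, smul_add]
    abel
  map_smul' c x := by
    simp only [Matrix.mul_smul, Matrix.smul_mul, RingHom.id_apply, smul_sub, smul_add,
      smul_comm c (1 / 2 : ℂ)]

/-- The overcomplete GKS matrix `A` of `lindbladian L`, with rows and columns indexed by pairs:
`A_{(k,l),(k',l')} = (1/2) L_{k,l} conj(L_{k',l'})`. -/
noncomputable def gksMatrix {D : Type} (L : Matrix D D ℂ) : Matrix (D × D) (D × D) ℂ :=
  Matrix.of fun p q => (1 / 2 : ℂ) * (L p.1 p.2 * star (L q.1 q.2))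

/-- The GKS matrix is positive semidefinite. -/
theorem gksMatrix_posSemidef {D : Type} [Fintype D] (L : Matrix D D ℂ) :
    (gksMatrix L).PosSemidef := by
  have h : gksMatrix L = (1 / 2 : ℂ) • Matrix.vecMulVec (fun p : D × D => L p.1 p.2)
      (star fun p : D × D => L p.1 p.2) := by
    ext p q
    simp [gksMatrix, Matrix.vecMulVec_apply]
  rw [h]
  refine (Matrix.posSemidef_vecMulVec_self_star _).smul ?_
  rw [Complex.le_def]
  norm_num

/-- The GKS matrix represents the Lindbladian in overcomplete GKS form (with `H = 0`):
`𝓛(ρ) = ∑ A_{(k,l),(k',l')} (2 ⟨l|ρ|l'⟩ |k⟩⟨k'| - δ_{kk'} |l'⟩⟨l| ρ - δ_{kk'} ρ |l'⟩⟨l|)`. -/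
theorem lindbladian_eq_gks {D : Type} [Fintype D] [DecidableEq D] (L ρ : Matrix D D ℂ) :
    lindbladian L ρ = ∑ k, ∑ l, ∑ k', ∑ l', gksMatrix L (k, l) (k', l') •
      ((2 * ρ l l') • Matrix.single k k' (1 : ℂ)
        - (if k = k' then (1 : ℂ) else 0) • (Matrix.single l' l (1 : ℂ) * ρ)
        - (if k = k' then (1 : ℂ) else 0) • (ρ * Matrix.single l' l (1 : ℂ))) := by
  have e1 : ∑ k, ∑ l, ∑ k', ∑ l', gksMatrix L (k, l) (k', l') •
      ((2 * ρ l l') • Matrix.single k k' (1 : ℂ)) = L * ρ * Lᴴ := by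
    ext i j
    simp only [Matrix.sum_apply, Matrix.smul_apply, Matrix.single_apply, smul_eq_mul, gksMatrix,
      Matrix.of_apply, mul_ite, mul_one, mul_zero, ite_and, Matrix.mul_apply,
      Matrix.conjTranspose_apply, Finset.sum_mul]
    simp only [Finset.sum_ite_eq', Finset.sum_ite_irrel,
      Finset.sum_const_zero, Finset.mem_univ, if_true]
    rw [Finset.sum_comm]
    refine Finset.sum_congr rfl fun _ _ => Finset.sum_congr rfl fun _ _ => ?_
    ring
  have e2 : ∑ k, ∑ l, ∑ k', ∑ l', gksMatrix L (k, l) (k', l') •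
      ((if k = k' then (1 : ℂ) else 0) • (Matrix.single l' l (1 : ℂ))) =
      (1 / 2 : ℂ) • (Lᴴ * L) := by
    ext i j
    simp only [Matrix.sum_apply, Matrix.smul_apply, Matrix.single_apply, smul_eq_mul, gksMatrix,
      Matrix.of_apply, mul_ite, mul_one, mul_zero, ite_and, Matrix.mul_apply,
      Matrix.conjTranspose_apply]
    simp only [Finset.sum_ite_eq', Finset.sum_ite_eq, Finset.sum_ite_irrel,
      Finset.sum_const_zero, Finset.mem_univ, if_true]
    rw [Finset.mul_sum]
    refine Finset.sum_congr rfl fun _ _ => ?_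
    ring
  have e3 : lindbladian L ρ = L * ρ * Lᴴ - ((1 / 2 : ℂ) • (Lᴴ * L)) * ρ
      - ρ * ((1 / 2 : ℂ) • (Lᴴ * L)) := by
    simp only [lindbladian, LinearMap.coe_mk, AddHom.coe_mk, Matrix.smul_mul, Matrix.mul_smul,
      smul_add]
    abel
  rw [e3, ← e1, ← e2]
  simp only [Finset.sum_mul, Finset.mul_sum, smul_sub, Finset.sum_sub_distrib, Matrix.smul_mul,
    Matrix.mul_smul]

/-- The trace norm: the sum of the singular values, i.e. of the square roots of the eigenvalues
of `X† X`. -/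
noncomputable def traceNorm {I : Type} [Fintype I] [DecidableEq I] (X : Matrix I I ℂ) : ℝ :=
  ∑ i, Real.sqrt ((isHermitian_conjTranspose_mul_self X).eigenvalues i)

/-- The map `Φ ⊗ id` on operators on `ℂ^D ⊗ ℂ^D`: apply `Φ` to every block. -/
def tensorId {D : Type} (Φ : Superop D) (X : Matrix (D × D) (D × D) ℂ) :
    Matrix (D × D) (D × D) ℂ :=
  Matrix.of fun p q => Φ (Matrix.of fun i j => X (i, p.2) (j, q.2)) p.1 q.1

/-- On product operators, `(Φ ⊗ id) (A ⊗ B) = Φ A ⊗ B`. -/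
theorem tensorId_kronecker {D : Type} (Φ : Superop D) (A B : Matrix D D ℂ) :
    tensorId Φ (A ⊗ₖ B) = Φ A ⊗ₖ B := by
  ext p q
  have h : (Matrix.of fun i j => (A ⊗ₖ B) (i, p.2) (j, q.2)) = B p.2 q.2 • A := by
    ext i j
    simp [mul_comm]
  change Φ (Matrix.of fun i j => (A ⊗ₖ B) (i, p.2) (j, q.2)) p.1 q.1 = _
  rw [h]
  simp [mul_comm]

/-- The diamond norm: the supremum of `‖(Φ ⊗ id) X‖₁` over all `X` on `ℂ^D ⊗ ℂ^D` with
`‖X‖₁ = 1` (valued in `[0, ∞]`, so that the supremum always exists). -/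
noncomputable def diamondNorm {D : Type} [Fintype D] [DecidableEq D] (Φ : Superop D) : ℝ≥0∞ :=
  ⨆ (X : Matrix (D × D) (D × D) ℂ) (_ : traceNorm X = 1), ENNReal.ofReal (traceNorm (tensorId Φ X))

/-- The evolution `exp (t 𝓛)` generated by a superoperator, computed as a matrix exponential in
the basis of matrix units. -/
noncomputable def evolution {D : Type} [Fintype D] [DecidableEq D] (𝓛 : Superop D) (t : ℝ) :
    Superop D :=
  Matrix.toLin (Matrix.stdBasis ℂ D D) (Matrix.stdBasis ℂ D D)
    (NormedSpace.exp ((t : ℂ) •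
      LinearMap.toMatrix (Matrix.stdBasis ℂ D D) (Matrix.stdBasis ℂ D D) 𝓛))

/-! ### Quantum query algorithms -/

/-- `b`-bit strings, with bitwise addition modulo 2. -/
abbrev Bits (b : ℕ) : Type := Fin b → ZMod 2

/-- The computational basis of the whole machine: the system register `S`, the query register
`Q`, a `b`-bit answer register, and a `w`-dimensional workspace. -/
abbrev Registers (S Q : Type) (b w : ℕ) : Type := S × (Q × Bits b × Fin w)

/-- A quantum query algorithm acting on a system with basis `S`, with query inputs `Q` and `b`-bit
answers: a workspace, an initial basis state of the ancilla registers, the number of queries, and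
the oracle-independent unitaries `gate 0, …, gate queries` applied before, between and after the
queries (later gates are not used). -/
structure QueryAlgorithm (S Q : Type) [Fintype S] [DecidableEq S] [Fintype Q] [DecidableEq Q]
    (b : ℕ) where
  workDim : ℕ
  init : Q × Bits b × Fin workDim
  queries : ℕ
  gate : ℕ → Matrix.unitaryGroup (Registers S Q b workDim) ℂ

/-- The oracle for `f : Q → Bits b`: the permutation matrix of
`|s, q, y, z⟩ ↦ |s, q, y + f q, z⟩`. -/
def oracle {S Q : Type} [DecidableEq S] [DecidableEq Q] {b : ℕ} (w : ℕ) (f : Q → Bits b) :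
    Matrix (Registers S Q b w) (Registers S Q b w) ℂ :=
  Matrix.of fun i j => if i = (j.1, j.2.1, j.2.2.1 + f j.2.1, j.2.2.2) then 1 else 0

/-- Partial trace over the second tensor factor. -/
def traceOut {S R : Type} [Fintype R] (M : Matrix (S × R) (S × R) ℂ) : Matrix S S ℂ :=
  Matrix.of fun i j => ∑ r, M (i, r) (j, r)

namespace QueryAlgorithm

variable {S Q : Type} [Fintype S] [DecidableEq S] [Fintype Q] [DecidableEq Q] {b : ℕ}

/-- The operator applied up to and including `gate k`, i.e. after `k` queries:
`U_k O_f U_{k-1} O_f ⋯ O_f U_0`. -/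
def partialRun (𝒜 : QueryAlgorithm S Q b) (f : Q → Bits b) :
    ℕ → Matrix (Registers S Q b 𝒜.workDim) (Registers S Q b 𝒜.workDim) ℂ
  | 0 => (𝒜.gate 0).1
  | k + 1 => (𝒜.gate (k + 1)).1 * oracle 𝒜.workDim f * partialRun 𝒜 f k

/-- The quantum operation on the system that the algorithm implements with the oracle for `f`:
adjoin the ancillas in their initial state, run, and trace out the ancillas. -/
noncomputable def channel (𝒜 : QueryAlgorithm S Q b) (f : Q → Bits b) : Superop S where
  toFun ρ := traceOut (𝒜.partialRun f 𝒜.queries *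
    (ρ ⊗ₖ Matrix.single 𝒜.init 𝒜.init (1 : ℂ)) * (𝒜.partialRun f 𝒜.queries)ᴴ)
  map_add' x y := by
    ext i j
    simp [traceOut, Matrix.add_kronecker, mul_add, add_mul, Finset.sum_add_distrib]
  map_smul' c x := by
    ext i j
    simp [traceOut, Matrix.smul_kronecker, Finset.mul_sum]

/-- The algorithm, run with the oracle for `f`, simulates the evolution of `𝓛` for time `t` within
precision `ε` in diamond norm. -/
def Simulates (𝒜 : QueryAlgorithm S Q b) (f : Q → Bits b) (𝓛 : Superop S) (t ε : ℝ) : Prop :=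
  diamondNorm (𝒜.channel f - evolution 𝓛 t) ≤ ENNReal.ofReal ε

end QueryAlgorithm

/-! ### The two black boxes and sparsity -/

/-- `L` has at most one nonzero entry in each row and in each column. -/
def IsOneSparse {D : Type} (L : Matrix D D ℂ) : Prop :=
  (∀ i, {j | L i j ≠ 0}.Subsingleton) ∧ (∀ j, {i | L i j ≠ 0}.Subsingleton)

/-- Entry access to the GKS matrix of `lindbladian L`: a query is a pair consisting of a row index
and a column index of `A`, the answer is the entry of `A` there, written as a bit string by means
of the encoding `enc`. -/
noncomputable def entryBox {D : Type} {b : ℕ} (enc : ℂ → Bits b) (L : Matrix D D ℂ) :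
    (D × D) × (D × D) → Bits b :=
  fun q => enc (gksMatrix L q.1 q.2)

/-- Sparse access to `L`: a query is a row index (`Sum.inl i`) or a column index (`Sum.inr j`) of
`L`, the answer is the set of the (location, value) pairs of all nonzero elements of that row or
column, written as a bit string by means of the encoding `enc`. -/
def sparseBox {D : Type} {b : ℕ} (enc : Set (D × ℂ) → Bits b) (L : Matrix D D ℂ) :
    D ⊕ D → Bits b
  | Sum.inl i => enc {p | p.2 ≠ 0 ∧ L i p.1 = p.2}
  | Sum.inr j => enc {p | p.2 ≠ 0 ∧ L p.1 j = p.2}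

/-!
A bit string `x` of length `N` is hidden in the Lindblad operator `hopOperator x`, which moves
`|k, j⟩` to `|k + 1, j + x k⟩` with amplitude `2^{-1/2}`. Started in `|0, 0⟩`, the Lindbladian
evolution is a classical pure birth process of rate `1 / 2` along the path of basis states
`hopPath x`, which ends in `|N, parity of x⟩` (`evolution_hopOperator_last`). The number of
attempted jumps up to time `4 N` is Poisson with mean `2 N`, so the end is reached except with
probability at most `(2 / e)^N` (`sum_birthWeight_lt`). Precise simulation for time `4 N` therefore
distinguishes even from odd parity.

Computing parity is hard by the polynomial method. The amplitudes after `T` queries to a black box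
whose answers each depend on at most `d` bits of `x` have degree at most `d T` in `x`, and output
probabilities have degree at most `2 d T` (`QueryAlgorithm.channel_mem_juntaSpan`), while functions
of degree less than `N` are uncorrelated with parity (`sum_bitSign_mul_eq_zero`). Hence
`N ≤ 2 d T`. Sparse access to the operator has `d = 1`; entry access to the GKS matrix, whose
entries are products of two entries of the operator, has `d = 2`.

The diamond norm enters in two ways. Entries of the output are controlled by it, and the
normalization `‖𝓛‖ = 1` is checked by trace norm duality (`norm_trace_mul_le`,
`exists_trace_mul_eq_traceNorm`): a Lindblad operator of operator norm `c` generates a Lindbladian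
of diamond norm at most `2 c²`, which is attained on a basis state that jumps at rate `c²`.
-/

/-! ### Duality for the trace norm -/

section TraceNorm

open scoped Matrix.Norms.L2Operator

variable {I : Type} [Fintype I] [DecidableEq I]

/-- Singular value data: `X† X = V diag(s)² V†` with `V` unitary, `s ≥ 0`, and the trace norm of `X`
is the sum of the `s i`. -/
theorem exists_singularValues (X : Matrix I I ℂ) :
    ∃ (V : unitaryGroup I ℂ) (s : I → ℝ), (∀ i, 0 ≤ s i) ∧ traceNorm X = ∑ i, s i ∧
      (V : Matrix I I ℂ)ᴴ * (Xᴴ * X) * V = diagonal fun i => ((s i : ℂ) * s i) := by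
  have hA := isHermitian_conjTranspose_mul_self X
  refine ⟨hA.eigenvectorUnitary, fun i => Real.sqrt (hA.eigenvalues i),
    fun i => Real.sqrt_nonneg _, rfl, ?_⟩
  have h := hA.conjStarAlgAut_star_eigenvectorUnitary
  rw [Unitary.conjStarAlgAut_star_apply] at h
  rw [← star_eq_conjTranspose, h]
  congr 1
  funext i
  have h0 : 0 ≤ hA.eigenvalues i := (posSemidef_conjTranspose_mul_self X).eigenvalues_nonneg i
  rw [← Complex.ofReal_mul, Real.mul_self_sqrt h0]
  rfl

theorem traceNorm_nonneg (X : Matrix I I ℂ) : 0 ≤ traceNorm X :=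
  Finset.sum_nonneg fun _ _ => Real.sqrt_nonneg _

/-- One half of trace norm duality, Hölder's inequality for the trace pairing. -/
theorem norm_trace_mul_le (W X : Matrix I I ℂ) : ‖(W * X).trace‖ ≤ ‖W‖ * traceNorm X := by
  obtain ⟨V, s, hs, hX, hV⟩ := exists_singularValues X
  have hVV : (V : Matrix I I ℂ) * (V : Matrix I I ℂ)ᴴ = 1 := by
    rw [← star_eq_conjTranspose]; exact Unitary.coe_mul_star_self V
  set B := X * (V : Matrix I I ℂ) with hB
  set A := (V : Matrix I I ℂ)ᴴ * W with hA
  have hAn : ‖A‖ = ‖W‖ := by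
    rw [hA, ← star_eq_conjTranspose]
    exact CStarRing.norm_coe_unitary_mul (star V) W
  have htr : (W * X).trace = (A * B).trace := by
    rw [hA, hB, ← Matrix.mul_assoc, Matrix.trace_mul_comm _ (V : Matrix I I ℂ),
      ← Matrix.mul_assoc, ← Matrix.mul_assoc, hVV, Matrix.one_mul]
  have hBB : Bᴴ * B = diagonal fun i => ((s i : ℂ) * s i) := by
    rw [← hV, hB, conjTranspose_mul]; simp only [Matrix.mul_assoc]
  have hcol : ∀ i, ‖WithLp.toLp 2 (fun k => B k i)‖ = s i := by
    intro i
    have h1 := congrFun (congrFun hBB i) i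
    rw [Matrix.mul_apply, diagonal_apply_eq] at h1
    have h2 : ((∑ k, ‖B k i‖ ^ 2 : ℝ) : ℂ) = ((s i * s i : ℝ) : ℂ) := by
      push_cast
      rw [← h1]
      refine Finset.sum_congr rfl fun k _ => ?_
      rw [conjTranspose_apply, mul_comm, Complex.star_def, Complex.mul_conj, Complex.normSq_eq_norm_sq]
      push_cast; rfl
    rw [EuclideanSpace.norm_eq]
    change Real.sqrt (∑ k, ‖B k i‖ ^ 2) = s i
    rw [Complex.ofReal_injective h2, Real.sqrt_mul_self (hs i)]
  rw [htr, hX, Matrix.trace, Finset.mul_sum]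
  refine (norm_sum_le _ _).trans (Finset.sum_le_sum fun i _ => ?_)
  rw [← hcol i, ← hAn]
  refine le_trans ?_ (l2_opNorm_mulVec A (WithLp.toLp 2 (fun k => B k i)))
  exact PiLp.norm_apply_le (WithLp.toLp 2 (A *ᵥ fun k => B k i)) i

/-- The other half of trace norm duality: the polar decomposition provides a contraction at which
the trace pairing attains the trace norm. -/
theorem exists_trace_mul_eq_traceNorm (X : Matrix I I ℂ) :
    ∃ U : Matrix I I ℂ, ‖U‖ ≤ 1 ∧ (U * X).trace = traceNorm X := by
  obtain ⟨V, s, hs, hX, hV⟩ := exists_singularValues X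
  have hVV : (V : Matrix I I ℂ)ᴴ * (V : Matrix I I ℂ) = 1 := by
    rw [← star_eq_conjTranspose]; exact Unitary.coe_star_mul_self V
  -- Entries of `E` at vanishing singular values are `0⁻¹ = 0`, so `E` is a pseudoinverse.
  set E : Matrix I I ℂ := diagonal fun i => ((s i : ℂ))⁻¹ with hE
  have hEH : Eᴴ = E := by
    rw [hE, diagonal_conjTranspose]
    congr 1; funext i; simp
  set B := X * (V : Matrix I I ℂ) with hB
  have hBB : Bᴴ * B = diagonal fun i => ((s i : ℂ) * s i) := by
    rw [← hV, hB, conjTranspose_mul]; simp only [Matrix.mul_assoc]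
  refine ⟨V * (E * Bᴴ), ?_, ?_⟩
  · rw [CStarRing.norm_coe_unitary_mul]
    have h1 : ‖(E * Bᴴ) * (E * Bᴴ)ᴴ‖ ≤ 1 := by
      have : (E * Bᴴ) * (E * Bᴴ)ᴴ = E * (Bᴴ * B) * E := by
        rw [conjTranspose_mul E, conjTranspose_conjTranspose, hEH]
        simp only [Matrix.mul_assoc]
      rw [this, hBB, hE, diagonal_mul_diagonal, diagonal_mul_diagonal, l2_opNorm_diagonal,
        pi_norm_le_iff_of_nonneg zero_le_one]
      intro i
      by_cases h : (s i : ℂ) = 0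
      · simp [h]
      · field_simp; simp
    rw [← star_eq_conjTranspose (E * Bᴴ), CStarRing.norm_self_mul_star] at h1
    nlinarith [norm_nonneg (E * Bᴴ)]
  · rw [hX, Matrix.mul_assoc, trace_mul_comm, Matrix.mul_assoc, Matrix.mul_assoc, ← hB, hBB, hE,
      diagonal_mul_diagonal, trace_diagonal]
    push_cast
    refine Finset.sum_congr rfl fun i _ => ?_
    by_cases h : (s i : ℂ) = 0
    · simp [h]
    · field_simp

theorem traceNorm_le_of_forall_trace {X : Matrix I I ℂ} {c : ℝ}
    (h : ∀ U : Matrix I I ℂ, ‖U‖ ≤ 1 → ‖(U * X).trace‖ ≤ c) : traceNorm X ≤ c := by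
  obtain ⟨U, hU, hX⟩ := exists_trace_mul_eq_traceNorm X
  have := h U hU
  rwa [hX, Complex.norm_real, Real.norm_of_nonneg (traceNorm_nonneg X)] at this

theorem norm_apply_le_traceNorm (X : Matrix I I ℂ) (i : I) : ‖X i i‖ ≤ traceNorm X := by
  have h := norm_trace_mul_le (diagonal (Pi.single i (1 : ℂ))) X
  have h1 : (diagonal (Pi.single i (1 : ℂ)) * X).trace = X i i := by
    simp [Matrix.trace, diagonal_mul, Pi.single_apply]
  rw [h1, l2_opNorm_diagonal, Pi.norm_single] at h
  simpa using h

theorem traceNorm_single_self (i : I) : traceNorm (Matrix.single i i (1 : ℂ)) = 1 := by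
  apply le_antisymm
  · refine traceNorm_le_of_forall_trace fun U hU => ?_
    have h1 : (U * Matrix.single i i (1 : ℂ)).trace = U i i := by
      simp [Matrix.trace_mul_single]
    rw [h1]
    refine le_trans ?_ hU
    have h2 := l2_opNorm_mulVec U (EuclideanSpace.single i (1 : ℂ))
    rw [EuclideanSpace.single, PiLp.norm_single, norm_one, mul_one] at h2
    refine le_trans ?_ h2
    have h3 := PiLp.norm_apply_le (p := 2) ((EuclideanSpace.equiv I ℂ).symm
      (U *ᵥ (EuclideanSpace.single i (1 : ℂ)).ofLp)) i
    simpa using h3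
  · simpa using norm_apply_le_traceNorm (Matrix.single i i (1 : ℂ)) i

/-- A Lindblad operator of operator norm `c` generates a map of trace norm at most `2 c²`. -/
theorem traceNorm_lindbladian_le (L X : Matrix I I ℂ) :
    traceNorm (lindbladian L X) ≤ 2 * ‖L‖ ^ 2 * traceNorm X := by
  refine traceNorm_le_of_forall_trace fun U hU => ?_
  have hL : ‖Lᴴ‖ = ‖L‖ := l2_opNorm_conjTranspose L
  have hX := traceNorm_nonneg X
  have bound : ∀ A : Matrix I I ℂ, ‖A‖ ≤ ‖L‖ ^ 2 → ‖(A * X).trace‖ ≤ ‖L‖ ^ 2 * traceNorm X :=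
    fun A hA => (norm_trace_mul_le A X).trans (mul_le_mul_of_nonneg_right hA hX)
  have hLL : ‖Lᴴ * L‖ ≤ ‖L‖ ^ 2 := by rw [l2_opNorm_conjTranspose_mul_self, pow_two]
  have e1 : ‖(U * (L * X * Lᴴ)).trace‖ ≤ ‖L‖ ^ 2 * traceNorm X := by
    have : (U * (L * X * Lᴴ)).trace = (Lᴴ * U * L * X).trace := by
      rw [← Matrix.mul_assoc, trace_mul_comm]
      simp only [Matrix.mul_assoc]
    rw [this]
    refine bound _ ((norm_mul_le _ _).trans ?_)
    have := (norm_mul_le Lᴴ U).trans (mul_le_of_le_one_right (norm_nonneg _) hU)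
    rw [hL] at this
    rw [pow_two]
    exact mul_le_mul_of_nonneg_right this (norm_nonneg _)
  have e2 : ‖(U * (Lᴴ * L * X)).trace‖ ≤ ‖L‖ ^ 2 * traceNorm X := by
    rw [← Matrix.mul_assoc]
    exact bound _ ((norm_mul_le _ _).trans ((mul_le_of_le_one_left (norm_nonneg _) hU).trans hLL))
  have e3 : ‖(U * (X * (Lᴴ * L))).trace‖ ≤ ‖L‖ ^ 2 * traceNorm X := by
    rw [← Matrix.mul_assoc, trace_mul_comm, ← Matrix.mul_assoc]
    exact bound _ ((norm_mul_le _ _).trans ((mul_le_of_le_one_right (norm_nonneg _) hU).trans hLL))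
  have e : (U * lindbladian L X).trace = (U * (L * X * Lᴴ)).trace
      - (1 / 2 : ℂ) * ((U * (Lᴴ * L * X)).trace + (U * (X * (Lᴴ * L))).trace) := by
    simp [lindbladian, Matrix.mul_sub, mul_add]
  rw [e]
  refine (norm_sub_le _ _).trans ?_
  rw [norm_mul]
  have h2 : ‖(1 / 2 : ℂ)‖ = 1 / 2 := by norm_num
  rw [h2]
  have := norm_add_le (U * (Lᴴ * L * X)).trace (U * (X * (Lᴴ * L))).trace
  linarith

end TraceNorm

/-! ### Degree of functions on the cube, and the parity bound -/

section Junta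

variable {ι : Type}

/-- The functions on the cube `{0, 1}^ι` of degree at most `d`, described as the span of the
functions that depend on at most `d` coordinates. -/
def juntaSpan (ι : Type) (d : ℕ) : Submodule ℂ ((ι → Fin 2) → ℂ) :=
  Submodule.span ℂ {f | ∃ S : Finset ι, S.card ≤ d ∧ ∀ x y, (∀ i ∈ S, x i = y i) → f x = f y}

theorem juntaSpan_const (c : ℂ) (d : ℕ) : (fun _ => c) ∈ juntaSpan ι d :=
  Submodule.subset_span ⟨∅, by simp, fun _ _ _ => rfl⟩

theorem juntaSpan_sum {κ : Type*} [Fintype κ] {d : ℕ} {f : κ → (ι → Fin 2) → ℂ}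
    (h : ∀ k, f k ∈ juntaSpan ι d) : (fun x => ∑ k, f k x) ∈ juntaSpan ι d := by
  have := Submodule.sum_mem (juntaSpan ι d) (t := Finset.univ) fun k _ => h k
  rwa [Finset.sum_fn] at this

theorem juntaSpan_mul {d e : ℕ} {f g : (ι → Fin 2) → ℂ} (hf : f ∈ juntaSpan ι d)
    (hg : g ∈ juntaSpan ι e) : (fun x => f x * g x) ∈ juntaSpan ι (d + e) := by
  classical
  have h : f * g ∈ juntaSpan ι d * juntaSpan ι e := Submodule.mul_mem_mul hf hg
  rw [juntaSpan, juntaSpan, Submodule.span_mul_span] at h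
  refine Submodule.span_mono ?_ h
  rintro _ ⟨u, ⟨S, hS, hu⟩, v, ⟨T, hT, hv⟩, rfl⟩
  refine ⟨S ∪ T, (Finset.card_union_le _ _).trans (add_le_add hS hT), fun x y hxy => ?_⟩
  change u x * v x = u y * v y
  rw [hu x y fun i hi => hxy i (Finset.mem_union_left _ hi),
    hv x y fun i hi => hxy i (Finset.mem_union_right _ hi)]

theorem juntaSpan_star {d : ℕ} {f : (ι → Fin 2) → ℂ} (hf : f ∈ juntaSpan ι d) :
    (fun x => star (f x)) ∈ juntaSpan ι d := by
  change star f ∈ juntaSpan ι d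
  induction hf using Submodule.span_induction with
  | mem u hu =>
    obtain ⟨S, hS, hu⟩ := hu
    exact Submodule.subset_span ⟨S, hS, fun x y hxy => congrArg star (hu x y hxy)⟩
  | zero => simp
  | add u v _ _ hu hv => rw [star_add]; exact add_mem hu hv
  | smul c u _ hu => rw [star_smul]; exact Submodule.smul_mem _ _ hu

/-- The sign character of the two-element group. -/
def bitSign (a : Fin 2) : ℂ := if a = 0 then 1 else -1

theorem bitSign_add_one (a : Fin 2) : bitSign (a + 1) = -bitSign a := by
  fin_cases a <;> simp [bitSign]

/-- A function of degree less than the number of bits is uncorrelated with parity: flipping a bit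
that a junta ignores changes the sign of the parity but not the junta. -/
theorem sum_bitSign_mul_eq_zero [Fintype ι] [DecidableEq ι] {d : ℕ} (hd : d < Fintype.card ι)
    {f : (ι → Fin 2) → ℂ} (hf : f ∈ juntaSpan ι d) :
    ∑ x, bitSign (∑ i, x i) * f x = 0 := by
  induction hf using Submodule.span_induction with
  | mem u hu =>
    obtain ⟨S, hS, hu⟩ := hu
    obtain ⟨i, hi⟩ : ∃ i, i ∉ S := by
      by_contra! h
      rw [(Finset.eq_univ_iff_forall.2 h), Finset.card_univ] at hS
      omega
    have flip : ∀ x : ι → Fin 2, ∑ j, (x + Pi.single i 1 : ι → Fin 2) j = (∑ j, x j) + 1 := fun x => by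
      simp [Finset.sum_add_distrib]
    refine Finset.sum_involution (fun x _ => x + Pi.single i 1) ?_ ?_ (by simp) ?_
    · intro x _
      have h : u (x + Pi.single i 1) = u x := hu _ _ fun j hj => by
        have : j ≠ i := fun e => hi (e ▸ hj)
        simp [this]
      rw [flip, bitSign_add_one, h]; ring
    · intro x _ _ h
      have := congrFun h i
      simp at this
    · intro x _
      have h2 : (1 : Fin 2) + 1 = 0 := rfl
      rw [add_assoc, ← Pi.single_add, h2, Pi.single_zero, add_zero]
  | zero => simp
  | add u v _ _ hu hv => simp [mul_add, Finset.sum_add_distrib, hu, hv]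
  | smul c u _ hu =>
    have : ∀ x, bitSign (∑ i, x i) * (c • u) x = c * (bitSign (∑ i, x i) * u x) := fun x => by
      simp only [Pi.smul_apply, smul_eq_mul]; ring
    simp only [this, ← Finset.mul_sum, hu, mul_zero]

end Junta

/-! ### The polynomial method for query algorithms -/

namespace QueryAlgorithm

variable {S Q ι : Type} [Fintype S] [DecidableEq S] [Fintype Q] [DecidableEq Q] {b : ℕ}

/-- If each answer of the black box depends on at most `d` of the bits of a hidden string `x`, the
amplitudes after `k` queries have degree at most `d k` in `x`. -/
theorem partialRun_mem_juntaSpan (𝒜 : QueryAlgorithm S Q b) {d : ℕ}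
    (F : (ι → Fin 2) → Q → Bits b)
    (hF : ∀ q, ∃ A : Finset ι, A.card ≤ d ∧ ∀ x y, (∀ i ∈ A, x i = y i) → F x q = F y q)
    (k : ℕ) (i j : Registers S Q b 𝒜.workDim) :
    (fun x => 𝒜.partialRun (F x) k i j) ∈ juntaSpan ι (d * k) := by
  induction k generalizing i j with
  | zero => exact juntaSpan_const _ _
  | succ k ih =>
    have horacle : ∀ u v : Registers S Q b 𝒜.workDim, (fun x => oracle 𝒜.workDim (F x) u v) ∈ juntaSpan ι d := by
      intro u v
      obtain ⟨A, hA, h⟩ := hF v.2.1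
      refine Submodule.subset_span ⟨A, hA, fun x y hxy => ?_⟩
      simp only [oracle, of_apply, h x y hxy]
    simp only [partialRun, Matrix.mul_apply, Nat.mul_succ]
    refine juntaSpan_sum fun u => ?_
    rw [add_comm]
    refine juntaSpan_mul (juntaSpan_sum fun v => ?_) (ih u j)
    simpa using juntaSpan_mul (juntaSpan_const _ 0) (horacle v u)

/-- Output probabilities are quadratic in the amplitudes, so their degree is at most `2 d T`. -/
theorem channel_mem_juntaSpan (𝒜 : QueryAlgorithm S Q b) {d : ℕ}
    (F : (ι → Fin 2) → Q → Bits b)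
    (hF : ∀ q, ∃ A : Finset ι, A.card ≤ d ∧ ∀ x y, (∀ i ∈ A, x i = y i) → F x q = F y q)
    (ρ : Matrix S S ℂ) (p q : S) :
    (fun x => 𝒜.channel (F x) ρ p q) ∈ juntaSpan ι (d * 𝒜.queries + d * 𝒜.queries) := by
  simp only [channel, LinearMap.coe_mk, AddHom.coe_mk, traceOut, of_apply, Matrix.mul_apply,
    conjTranspose_apply]
  have hrun := 𝒜.partialRun_mem_juntaSpan F hF 𝒜.queries
  refine juntaSpan_sum fun r => juntaSpan_sum fun v => juntaSpan_mul (juntaSpan_sum fun u => ?_)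
    (juntaSpan_star (hrun _ _))
  simpa using juntaSpan_mul (hrun (p, r) u) (juntaSpan_const _ 0)

/-- Query lower bound for parity: if some entry of the output exceeds `c` in real part when the
parity of the hidden string is even and is at most `c` when it is odd, then `2 d T ≥ |ι|`. -/
theorem card_le_of_parity_separation [Fintype ι] [DecidableEq ι] (𝒜 : QueryAlgorithm S Q b) {d : ℕ}
    (F : (ι → Fin 2) → Q → Bits b)
    (hF : ∀ q, ∃ A : Finset ι, A.card ≤ d ∧ ∀ x y, (∀ i ∈ A, x i = y i) → F x q = F y q)
    [Nonempty ι] (ρ : Matrix S S ℂ) (p q : S) (c : ℝ)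
    (h0 : ∀ x : ι → Fin 2, ∑ i, x i = 0 → c < (𝒜.channel (F x) ρ p q).re)
    (h1 : ∀ x : ι → Fin 2, ∑ i, x i ≠ 0 → (𝒜.channel (F x) ρ p q).re ≤ c) :
    Fintype.card ι ≤ 2 * d * 𝒜.queries := by
  by_contra! hlt
  have hz := sum_bitSign_mul_eq_zero (by linarith) (𝒜.channel_mem_juntaSpan F hF ρ p q)
  have hc := sum_bitSign_mul_eq_zero Fintype.card_pos (juntaSpan_const (ι := ι) (c : ℂ) 0)
  -- Subtracting the constant `c`, which parity also annihilates, makes every term nonnegative.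
  have hsum : 0 < ∑ x : ι → Fin 2,
      (bitSign (∑ i, x i) * (𝒜.channel (F x) ρ p q) - bitSign (∑ i, x i) * c).re := by
    refine Finset.sum_pos' (fun x _ => ?_) ⟨0, Finset.mem_univ _, ?_⟩
    · by_cases h : ∑ i, x i = 0
      · simpa [bitSign, h] using (h0 x h).le
      · simpa [bitSign, h] using h1 x h
    · simpa [bitSign] using h0 0 (by simp)
  rw [← Complex.re_sum, Finset.sum_sub_distrib, hz, hc] at hsum
  simp at hsum

end QueryAlgorithm

/-! ### The diamond norm: upper bound for Lindbladians, and reading off output entries -/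

section Diamond

variable {D : Type} [Fintype D] [DecidableEq D]

theorem block_kronecker_one_mul (A : Matrix D D ℂ) (X : Matrix (D × D) (D × D) ℂ) (r s : D) :
    (Matrix.of fun i j => ((A ⊗ₖ (1 : Matrix D D ℂ)) * X) (i, r) (j, s)) =
      A * Matrix.of fun i j => X (i, r) (j, s) := by
  ext i j
  simp [Matrix.mul_apply, Fintype.sum_prod_type, Matrix.one_apply]

theorem block_mul_kronecker_one (A : Matrix D D ℂ) (X : Matrix (D × D) (D × D) ℂ) (r s : D) :
    (Matrix.of fun i j => (X * (A ⊗ₖ (1 : Matrix D D ℂ))) (i, r) (j, s)) =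
      (Matrix.of fun i j => X (i, r) (j, s)) * A := by
  ext i j
  simp [Matrix.mul_apply, Fintype.sum_prod_type, Matrix.one_apply]

/-- Tensoring a Lindbladian with the identity amounts to tensoring its Lindblad operator. -/
theorem tensorId_lindbladian (L : Matrix D D ℂ) (X : Matrix (D × D) (D × D) ℂ) :
    tensorId (lindbladian L) X = lindbladian (L ⊗ₖ (1 : Matrix D D ℂ)) X := by
  have hH : (L ⊗ₖ (1 : Matrix D D ℂ))ᴴ = Lᴴ ⊗ₖ (1 : Matrix D D ℂ) := by
    rw [conjTranspose_kronecker, conjTranspose_one]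
  have hHH : (Lᴴ ⊗ₖ (1 : Matrix D D ℂ)) * (L ⊗ₖ (1 : Matrix D D ℂ)) =
      (Lᴴ * L) ⊗ₖ (1 : Matrix D D ℂ) := by
    rw [← mul_kronecker_mul, Matrix.one_mul]
  ext p q
  have e1 := congrFun (congrFun (block_kronecker_one_mul L
    (X * (Lᴴ ⊗ₖ (1 : Matrix D D ℂ))) p.2 q.2) p.1) q.1
  rw [block_mul_kronecker_one, ← Matrix.mul_assoc, ← Matrix.mul_assoc] at e1
  have e2 := congrFun (congrFun (block_kronecker_one_mul (Lᴴ * L) X p.2 q.2) p.1) q.1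
  have e3 := congrFun (congrFun (block_mul_kronecker_one (Lᴴ * L) X p.2 q.2) p.1) q.1
  simp only [of_apply, Prod.mk.eta] at e1 e2 e3
  simp only [tensorId, lindbladian, LinearMap.coe_mk, AddHom.coe_mk, of_apply, hH, hHH,
    Matrix.sub_apply, Matrix.add_apply, Matrix.smul_apply, e1, e2, e3]

theorem diamondNorm_lindbladian_le_one {L : Matrix D D ℂ} {w : D → ℂ}
    (hL : Lᴴ * L = diagonal w) (hw : ∀ i, ‖w i‖ ≤ 1 / 2) : diamondNorm (lindbladian L) ≤ 1 := by
  open scoped Matrix.Norms.L2Operator in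
  have hn : ‖L ⊗ₖ (1 : Matrix D D ℂ)‖ ^ 2 ≤ 1 / 2 := by
    rw [pow_two, ← l2_opNorm_conjTranspose_mul_self, conjTranspose_kronecker, conjTranspose_one,
      ← mul_kronecker_mul, Matrix.one_mul, hL, ← diagonal_one, diagonal_kronecker_diagonal,
      l2_opNorm_diagonal, pi_norm_le_iff_of_nonneg (by norm_num)]
    intro i
    simpa using hw i.1
  refine iSup₂_le fun X hX => ?_
  rw [tensorId_lindbladian]
  have h := traceNorm_lindbladian_le (L ⊗ₖ (1 : Matrix D D ℂ)) X
  rw [hX] at h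
  exact ENNReal.ofReal_le_one.2 (by linarith)

theorem ofReal_traceNorm_le_diamondNorm (Φ : Superop D) (v : D) :
    ENNReal.ofReal (traceNorm (Φ (single v v 1) ⊗ₖ single v v (1 : ℂ))) ≤ diamondNorm Φ := by
  rw [← tensorId_kronecker]
  refine le_iSup₂_of_le (single v v (1 : ℂ) ⊗ₖ single v v (1 : ℂ)) ?_ le_rfl
  rw [single_kronecker_single, mul_one]
  exact traceNorm_single_self _

theorem norm_apply_le_of_diamondNorm_le {Φ : Superop D} {ε : ℝ} (hε : 0 ≤ ε)
    (h : diamondNorm Φ ≤ ENNReal.ofReal ε) (v p : D) : ‖Φ (single v v 1) p p‖ ≤ ε := by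
  have h1 := (ENNReal.ofReal_le_ofReal_iff hε).1 ((ofReal_traceNorm_le_diamondNorm Φ v).trans h)
  refine le_trans ?_ ((norm_apply_le_traceNorm _ (p, v)).trans h1)
  simp

/-- A Lindbladian that moves the basis state `v` to `w` at rate `1 / 2` has diamond norm at least
`1`: the trace pairing with the reflection about the complement of `v` has value `1`. -/
theorem one_le_diamondNorm_of_hop {Φ : Superop D} {v w : D} (hvw : v ≠ w)
    (h : Φ (single v v 1) = (1 / 2 : ℂ) • (single w w 1 - single v v 1)) :
    1 ≤ diamondNorm Φ := by
  refine le_trans ?_ (ofReal_traceNorm_le_diamondNorm Φ v)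
  rw [ENNReal.one_le_ofReal, h]
  set σ : D → ℂ := fun i => if i = v then -1 else 1 with hσ
  open scoped Matrix.Norms.L2Operator in
  have hW : ‖(diagonal σ ⊗ₖ (1 : Matrix D D ℂ))‖ ≤ 1 := by
    rw [← diagonal_one, diagonal_kronecker_diagonal, l2_opNorm_diagonal,
      pi_norm_le_iff_of_nonneg zero_le_one]
    intro i
    by_cases hi : i.1 = v <;> simp [hσ, hi]
  refine le_trans ?_ ((norm_trace_mul_le (diagonal σ ⊗ₖ (1 : Matrix D D ℂ)) _).trans
    (mul_le_of_le_one_left (traceNorm_nonneg _) hW))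
  rw [← mul_kronecker_mul, trace_kronecker]
  have : (diagonal σ * (1 / 2 : ℂ) • (single w w 1 - single v v 1)).trace = 1 := by
    simp [Matrix.mul_sub, trace_mul_single, hσ, hvw.symm]
    norm_num
  rw [this]
  simp

end Diamond

/-! ### A pure birth process solves the master equation -/

section Birth

/-- The Poisson weight `e^{-rt} (rt)^k / k!`. -/
noncomputable def birthWeight (r : ℝ) (k : ℕ) (t : ℝ) : ℝ :=
  Real.exp (-(r * t)) * ((r * t) ^ k / k.factorial)

/-- The state at time `t` of the process that starts at `E 0` and moves from `E k` to `E (k + 1)` at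
rate `r` as long as `k < n`. -/
noncomputable def birthState {V : Type*} [AddCommGroup V] [Module ℝ V] (r : ℝ) (E : ℕ → V) (n : ℕ)
    (t : ℝ) : V :=
  ∑ k ∈ Finset.range n, birthWeight r k t • E k +
    (1 - ∑ k ∈ Finset.range n, birthWeight r k t) • E n

/-- The time derivative of the Poisson weights, divided by the rate. -/
noncomputable def birthFlow (r : ℝ) (t : ℝ) : ℕ → ℝ
  | 0 => -birthWeight r 0 t
  | k + 1 => birthWeight r k t - birthWeight r (k + 1) t

theorem hasDerivAt_birthWeight (r : ℝ) (k : ℕ) (t : ℝ) :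
    HasDerivAt (birthWeight r k) (r * birthFlow r t k) t := by
  have hlin : HasDerivAt (fun s : ℝ => r * s) r t := by simpa using (hasDerivAt_id t).const_mul r
  have h := hlin.neg.exp.mul ((hlin.pow k).div_const (k.factorial : ℝ))
  refine h.congr_deriv ?_
  cases k with
  | zero => simp [birthFlow, birthWeight]; ring
  | succ k =>
    simp only [birthFlow, birthWeight, Nat.factorial_succ, Nat.add_sub_cancel]
    have : (k.factorial : ℝ) ≠ 0 := by positivity
    push_cast
    field_simp
    simp only [Pi.neg_apply, Pi.pow_apply]
    ring

theorem sum_birthFlow (r t : ℝ) (n : ℕ) :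
    ∑ k ∈ Finset.range (n + 1), birthFlow r t k = -birthWeight r n t := by
  induction n with
  | zero => simp [birthFlow]
  | succ n ih => rw [Finset.sum_range_succ, ih, birthFlow]; ring

theorem sum_birthFlow_smul {V : Type*} [AddCommGroup V] [Module ℝ V] (r t : ℝ) (E : ℕ → V) (n : ℕ) :
    ∑ k ∈ Finset.range n, birthFlow r t k • (E k - E n) =
      ∑ k ∈ Finset.range n, birthWeight r k t • (E (k + 1) - E k) := by
  induction n with
  | zero => simp
  | succ n ih =>
    rw [Finset.sum_range_succ _ n, Finset.sum_range_succ _ n, ← ih]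
    have h : ∀ k, birthFlow r t k • (E k - E (n + 1)) =
        birthFlow r t k • (E k - E n) + birthFlow r t k • (E n - E (n + 1)) := fun k => by
      rw [← smul_add]; congr 1; abel
    rw [Finset.sum_congr rfl fun k _ => h k, Finset.sum_add_distrib, add_assoc, ← Finset.sum_smul,
      ← add_smul, ← Finset.sum_range_succ, sum_birthFlow, neg_smul, ← smul_neg, neg_sub]

theorem hasDerivAt_birthState {V : Type*} [NormedAddCommGroup V] [NormedSpace ℝ V] {r : ℝ}
    {E : ℕ → V} {n : ℕ} {A : V →ₗ[ℝ] V} (hA : ∀ k < n, A (E k) = r • (E (k + 1) - E k))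
    (hn : A (E n) = 0) (t : ℝ) :
    HasDerivAt (birthState r E n) (A (birthState r E n t)) t := by
  have h1 : HasDerivAt (fun s => ∑ k ∈ Finset.range n, birthWeight r k s • E k)
      (∑ k ∈ Finset.range n, (r * birthFlow r t k) • E k) t :=
    HasDerivAt.fun_sum fun k _ => (hasDerivAt_birthWeight r k t).smul_const (E k)
  have h2 : HasDerivAt (fun s => ∑ k ∈ Finset.range n, birthWeight r k s)
      (∑ k ∈ Finset.range n, r * birthFlow r t k) t :=
    HasDerivAt.fun_sum fun k _ => hasDerivAt_birthWeight r k t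
  refine (h1.add ((h2.const_sub 1).smul_const (E n))).congr_deriv ?_
  have e1 : A (birthState r E n t) =
      r • ∑ k ∈ Finset.range n, birthWeight r k t • (E (k + 1) - E k) := by
    rw [birthState, map_add, map_smul, hn, smul_zero, add_zero, map_sum, Finset.smul_sum]
    refine Finset.sum_congr rfl fun k hk => ?_
    rw [map_smul, hA k (Finset.mem_range.1 hk), smul_comm]
  rw [e1, ← sum_birthFlow_smul, Finset.smul_sum, neg_smul, Finset.sum_smul, ← sub_eq_add_neg,
    ← Finset.sum_sub_distrib]
  exact Finset.sum_congr rfl fun k _ => by rw [← smul_sub, mul_smul]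

/-- The Chernoff bound `P(Poisson(2N) < N) ≤ (2 / e)^N`, which is less than `3 / 4`. -/
theorem sum_birthWeight_lt {N : ℕ} (hN : 0 < N) :
    ∑ k ∈ Finset.range N, birthWeight (1 / 2) k (4 * N) < 3 / 4 := by
  have h1 : ∑ k ∈ Finset.range N, birthWeight (1 / 2) k (4 * N) ≤
      Real.exp (-(2 * N)) * (2 ^ N * Real.exp N) := by
    have hr : (1 / 2 : ℝ) * (4 * N) = 2 * N := by ring
    simp only [birthWeight, hr]
    rw [← Finset.mul_sum]
    refine mul_le_mul_of_nonneg_left ?_ (Real.exp_pos _).le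
    refine le_trans ?_ (mul_le_mul_of_nonneg_left
      (Real.sum_le_exp_of_nonneg (Nat.cast_nonneg N) N) (by positivity))
    rw [Finset.mul_sum]
    refine Finset.sum_le_sum fun k hk => ?_
    rw [mul_pow, mul_div_assoc]
    exact mul_le_mul_of_nonneg_right
      (pow_le_pow_right₀ one_le_two (Finset.mem_range.1 hk).le) (by positivity)
  have h2 : Real.exp (-(2 * N)) * (2 ^ N * Real.exp N) = (2 * Real.exp (-1)) ^ N := by
    rw [mul_pow, ← Real.exp_nat_mul, mul_left_comm, ← Real.exp_add]
    congr 2; ring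
  have h3 : 2 * Real.exp (-1) < 3 / 4 := by linarith [Real.exp_neg_one_lt_d9]
  rw [h2] at h1
  exact (h1.trans (pow_le_of_le_one (by positivity) (by linarith) hN.ne')).trans_lt h3

end Birth

/-! ### Uniqueness of solutions of the master equation -/

section Evolution

open scoped Matrix.Norms.Operator

theorem exp_smul_mulVec_eq_of_hasDerivAt {m : Type} [Fintype m] [DecidableEq m]
    (M : Matrix m m ℂ) {u : ℝ → m → ℂ} (hu : ∀ t, HasDerivAt u (M *ᵥ u t) t) (t : ℝ) :
    NormedSpace.exp ((t : ℂ) • M) *ᵥ u 0 = u t := by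
  let K : (m → ℂ) →L[ℝ] (m → ℂ) := (M.mulVecLin.restrictScalars ℝ).toContinuousLinearMap
  let ev : Matrix m m ℂ →L[ℝ] (m → ℂ) := LinearMap.toContinuousLinearMap
    { toFun := fun A => A *ᵥ u 0
      map_add' := fun A B => add_mulVec A B _
      map_smul' := fun c A => smul_mulVec c A _ }
  have hexp : ∀ s : ℝ, HasDerivAt (fun s : ℝ => NormedSpace.exp (s • M) *ᵥ u 0)
      (K (NormedSpace.exp (s • M) *ᵥ u 0)) s := fun s => by
    have := ev.hasFDerivAt.comp_hasDerivAt s (hasDerivAt_exp_smul_const' (𝕂 := ℝ) M s)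
    refine this.congr_deriv ?_
    change (M * NormedSpace.exp (s • M)) *ᵥ u 0 = M *ᵥ (NormedSpace.exp (s • M) *ᵥ u 0)
    rw [mulVec_mulVec]
  have huniq := ODE_solution_unique_univ (v := fun _ => K) (s := fun _ => Set.univ) (t₀ := 0)
    (fun _ => K.lipschitz.lipschitzOnWith) (fun s => ⟨hexp s, Set.mem_univ _⟩)
    (fun s => ⟨hu s, Set.mem_univ _⟩) (by simp)
  have h : (t : ℂ) • M = t • M := by ext; simp
  rw [h]
  exact congrFun huniq t

end Evolution

theorem evolution_eq_birthState {D : Type} [Fintype D] [DecidableEq D] {𝓛 : Superop D} {r : ℝ}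
    {E : ℕ → Matrix D D ℂ} {n : ℕ} (hE : ∀ k < n, 𝓛 (E k) = r • (E (k + 1) - E k))
    (hn : 𝓛 (E n) = 0) (t : ℝ) : evolution 𝓛 t (E 0) = birthState r E n t := by
  set β := Matrix.stdBasis ℂ D D with hβ
  set M := LinearMap.toMatrix β β 𝓛 with hM
  have hrepr : ∀ ρ, M *ᵥ β.equivFun ρ = β.equivFun (𝓛 ρ) := fun ρ =>
    LinearMap.toMatrix_mulVec_repr β β 𝓛 ρ
  have hsmul : ∀ (c : ℝ) ρ, β.equivFun (c • ρ) = c • β.equivFun ρ := fun c ρ =>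
    LinearMap.map_smul_of_tower β.equivFun.toLinearMap c ρ
  have hstate : ∀ s, birthState r (fun k => β.equivFun (E k)) n s =
      β.equivFun (birthState r E n s) := fun s => by
    simp only [birthState, map_add, map_sum, hsmul]
  have hzero : birthState r E n 0 = E 0 := by
    cases n with
    | zero => simp [birthState]
    | succ n => simp [birthState, birthWeight, Finset.sum_range_succ']
  have h := exp_smul_mulVec_eq_of_hasDerivAt M (u := birthState r (fun k => β.equivFun (E k)) n)
    (hasDerivAt_birthState (A := M.mulVecLin.restrictScalars ℝ)
      (fun k hk => by
        change M *ᵥ _ = _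
        rw [hrepr, hE k hk, hsmul, map_sub])
      (by
        change M *ᵥ _ = _
        rw [hrepr, hn, map_zero])) t
  rw [hstate, hstate, hzero] at h
  apply β.equivFun.injective
  rw [← h]
  change ⇑(β.repr (Matrix.toLin β β (NormedSpace.exp ((t : ℂ) • M)) (E 0))) = _
  rw [← LinearMap.toMatrix_mulVec_repr β β, LinearMap.toMatrix_toLin]
  rfl

/-! ### Lindblad operators that hop along a line while adding up hidden bits -/

section Hop

variable {N : ℕ}

theorem diagonal_mul_single_self {D : Type} [Fintype D] [DecidableEq D] (w : D → ℂ) (v : D) :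
    diagonal w * single v v 1 = w v • single v v (1 : ℂ) := by
  ext p q
  by_cases h : v = p
  · subst h; simp [diagonal_mul]
  · simp [diagonal_mul, h]

theorem single_self_mul_diagonal {D : Type} [Fintype D] [DecidableEq D] (w : D → ℂ) (v : D) :
    single v v 1 * diagonal w = w v • single v v (1 : ℂ) := by
  ext p q
  by_cases h : v = q
  · subst h; simp [mul_diagonal, mul_comm]
  · simp [mul_diagonal, h]

/-- The Lindblad operator `∑ 2^{-1/2} |k + 1, j + x k⟩⟨k, j|` on `ℂ^(N+1) ⊗ ℂ^2`. -/
noncomputable def hopOperator (x : Fin N → Fin 2) :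
    Matrix (Fin (N + 1) × Fin 2) (Fin (N + 1) × Fin 2) ℂ :=
  Matrix.of fun p q =>
    if ∃ k : Fin N, p.1 = k.succ ∧ q.1 = k.castSucc ∧ p.2 = q.2 + x k then
      (((Real.sqrt 2)⁻¹ : ℝ) : ℂ) else 0

theorem hopOperator_apply_congr {x y : Fin N → Fin 2} {p q : Fin (N + 1) × Fin 2}
    (h : ∀ k : Fin N, p.1 = k.succ → q.1 = k.castSucc → x k = y k) :
    hopOperator x p q = hopOperator y p q := by
  simp only [hopOperator, of_apply]
  congr 1
  refine propext (exists_congr fun k => ?_)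
  constructor
  · rintro ⟨h1, h2, h3⟩; exact ⟨h1, h2, by rw [h3, h k h1 h2]⟩
  · rintro ⟨h1, h2, h3⟩; exact ⟨h1, h2, by rw [h3, h k h1 h2]⟩

theorem hopOperator_apply_castSucc (x : Fin N → Fin 2) (p : Fin (N + 1) × Fin 2) (k : Fin N)
    (j : Fin 2) : hopOperator x p (k.castSucc, j) =
      if p = (k.succ, j + x k) then (((Real.sqrt 2)⁻¹ : ℝ) : ℂ) else 0 := by
  simp only [hopOperator, of_apply]
  congr 1
  refine propext ⟨?_, ?_⟩
  · rintro ⟨l, h1, h2, h3⟩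
    obtain rfl := Fin.castSucc_injective _ h2
    exact Prod.ext h1 h3
  · rintro rfl
    exact ⟨k, rfl, rfl, rfl⟩

theorem hopOperator_apply_last (x : Fin N → Fin 2) (p : Fin (N + 1) × Fin 2) (j : Fin 2) :
    hopOperator x p (Fin.last N, j) = 0 := by
  simp only [hopOperator, of_apply]
  refine if_neg ?_
  rintro ⟨k, -, h, -⟩
  exact absurd h.symm (Fin.castSucc_lt_last k).ne

theorem isOneSparse_hopOperator (x : Fin N → Fin 2) : IsOneSparse (hopOperator x) := by
  have key : ∀ p q, hopOperator x p q ≠ 0 →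
      ∃ k : Fin N, p.1 = k.succ ∧ q.1 = k.castSucc ∧ p.2 = q.2 + x k := fun p q h => by
    by_contra hne
    exact h (by simp only [hopOperator, of_apply, if_neg hne])
  constructor
  · intro p q hq r hr
    obtain ⟨k, h1, h2, h3⟩ := key p q hq
    obtain ⟨l, h4, h5, h6⟩ := key p r hr
    obtain rfl := Fin.succ_injective _ (h1.symm.trans h4)
    exact Prod.ext (h2.trans h5.symm) (add_right_cancel (h3.symm.trans h6))
  · intro q p hp r hr
    obtain ⟨k, h1, h2, h3⟩ := key p q hp
    obtain ⟨l, h4, h5, h6⟩ := key r q hr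
    obtain rfl := Fin.castSucc_injective _ (h2.symm.trans h5)
    exact Prod.ext (h1.trans h4.symm) (h3.trans h6.symm)

theorem inv_sqrt_two_mul_self :
    (((Real.sqrt 2)⁻¹ : ℝ) : ℂ) * (((Real.sqrt 2)⁻¹ : ℝ) : ℂ) = 1 / 2 := by
  rw [← Complex.ofReal_mul, ← mul_inv, Real.mul_self_sqrt zero_le_two]
  norm_num

theorem conjTranspose_mul_self_hopOperator (x : Fin N → Fin 2) :
    (hopOperator x)ᴴ * hopOperator x =
      diagonal fun q => if q.1 = Fin.last N then 0 else 1 / 2 := by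
  ext p q
  rw [Matrix.mul_apply]
  simp only [conjTranspose_apply]
  obtain ⟨q, j⟩ := q
  obtain ⟨p, i⟩ := p
  induction q using Fin.lastCases with
  | last =>
    simp only [hopOperator_apply_last, mul_zero, Finset.sum_const_zero, diagonal_apply]
    split_ifs with h h' <;> simp_all
  | cast k =>
    simp only [hopOperator_apply_castSucc, mul_ite, mul_zero, Finset.sum_ite_eq', Finset.mem_univ,
      if_true]
    induction p using Fin.lastCases with
    | last =>
      rw [hopOperator_apply_last, diagonal_apply_ne]
      · simp
      · simp [(Fin.castSucc_lt_last k).ne']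
    | cast l =>
      rw [hopOperator_apply_castSucc]
      by_cases h : l = k ∧ i = j
      · obtain ⟨rfl, rfl⟩ := h
        have hl : l.castSucc ≠ Fin.last N := (Fin.castSucc_lt_last l).ne
        rw [if_pos rfl, diagonal_apply_eq, if_neg hl, ← inv_sqrt_two_mul_self, Complex.star_def,
          Complex.conj_ofReal]
      · rw [diagonal_apply_ne, if_neg, star_zero, zero_mul]
        · rintro e
          obtain ⟨e1, e2⟩ := Prod.mk.inj e
          obtain rfl := Fin.succ_injective _ e1
          exact h ⟨rfl, (add_right_cancel e2).symm⟩
        · intro e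
          obtain ⟨e1, e2⟩ := Prod.mk.inj e
          exact h ⟨Fin.castSucc_injective _ e1, e2⟩

/-- The jump moves `|k, j⟩⟨k, j|` to the next site at rate `1 / 2`, with no coherent part. -/
theorem lindbladian_hopOperator_castSucc (x : Fin N → Fin 2) (k : Fin N) (j : Fin 2) :
    lindbladian (hopOperator x) (single (k.castSucc, j) (k.castSucc, j) 1) =
      (1 / 2 : ℂ) • (single (k.succ, j + x k) (k.succ, j + x k) 1 -
        single (k.castSucc, j) (k.castSucc, j) 1) := by
  have hk : k.castSucc ≠ Fin.last N := (Fin.castSucc_lt_last k).ne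
  have h1 : hopOperator x * single (k.castSucc, j) (k.castSucc, j) 1 * (hopOperator x)ᴴ =
      (1 / 2 : ℂ) • single (k.succ, j + x k) (k.succ, j + x k) 1 := by
    ext p q
    simp only [Matrix.mul_apply, Matrix.single_apply, ite_and, ite_mul, zero_mul,
      Finset.sum_ite_eq, Finset.mem_univ, if_true,
      mul_ite, mul_zero, conjTranspose_apply, hopOperator_apply_castSucc, Matrix.smul_apply,
      smul_eq_mul, mul_one]
    rw [← inv_sqrt_two_mul_self]
    by_cases hp : p = (k.succ, j + x k) <;> by_cases hq : q = (k.succ, j + x k) <;>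
      simp [hp, hq, eq_comm]
  have h2 : (hopOperator x)ᴴ * hopOperator x * single (k.castSucc, j) (k.castSucc, j) 1 =
      (1 / 2 : ℂ) • single (k.castSucc, j) (k.castSucc, j) 1 := by
    rw [conjTranspose_mul_self_hopOperator, diagonal_mul_single_self]
    simp [hk]
  have h3 : single (k.castSucc, j) (k.castSucc, j) 1 * ((hopOperator x)ᴴ * hopOperator x) =
      (1 / 2 : ℂ) • single (k.castSucc, j) (k.castSucc, j) 1 := by
    rw [conjTranspose_mul_self_hopOperator, single_self_mul_diagonal]
    simp [hk]
  simp only [lindbladian, LinearMap.coe_mk, AddHom.coe_mk, h1, h2, h3]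
  module

theorem lindbladian_hopOperator_last (x : Fin N → Fin 2) (j : Fin 2) :
    lindbladian (hopOperator x) (single (Fin.last N, j) (Fin.last N, j) 1) = 0 := by
  have h1 : hopOperator x * single (Fin.last N, j) (Fin.last N, j) 1 = 0 := by
    ext p q
    rw [Matrix.mul_apply]
    refine Finset.sum_eq_zero fun u _ => ?_
    rw [Matrix.single_apply]
    split_ifs with h
    · rw [← h.1, hopOperator_apply_last, zero_mul]
    · rw [mul_zero]
  have h3 : single (Fin.last N, j) (Fin.last N, j) 1 * ((hopOperator x)ᴴ * hopOperator x) = 0 := by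
    rw [conjTranspose_mul_self_hopOperator, single_self_mul_diagonal]
    simp
  simp only [lindbladian, LinearMap.coe_mk, AddHom.coe_mk, Matrix.mul_assoc _ _ (single _ _ _), h1,
    h3]
  simp

theorem diamondNorm_lindbladian_hopOperator (hN : 0 < N) (x : Fin N → Fin 2) :
    diamondNorm (lindbladian (hopOperator x)) = 1 := by
  apply le_antisymm
  · refine diamondNorm_lindbladian_le_one (conjTranspose_mul_self_hopOperator x) fun q => ?_
    split_ifs <;> norm_num
  · refine one_le_diamondNorm_of_hop ?_ (lindbladian_hopOperator_castSucc x ⟨0, hN⟩ 0)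
    intro h
    exact (Fin.castSucc_lt_succ (i := ⟨0, hN⟩)).ne (congrArg Prod.fst h)

/-- The basis state reached from `|0, 0⟩` after `k` jumps: the second register holds the sum of the
first `k` bits. -/
def hopPath (x : Fin N → Fin 2) (k : ℕ) : Fin (N + 1) × Fin 2 :=
  (Fin.ofNat (N + 1) k, ∑ i : Fin N, if i.val < k then x i else 0)

theorem hopPath_zero (x : Fin N → Fin 2) : hopPath x 0 = (0, 0) := by
  simp [hopPath]

theorem hopPath_self (x : Fin N → Fin 2) : hopPath x N = (Fin.last N, ∑ i, x i) := by
  simp [hopPath]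

theorem hopPath_val_fst (x : Fin N → Fin 2) {k : ℕ} (hk : k ≤ N) : (hopPath x k).1.val = k :=
  Nat.mod_eq_of_lt (Nat.lt_succ_of_le hk)

theorem hopPath_val (x : Fin N → Fin 2) (k : Fin N) :
    hopPath x k = (k.castSucc, (hopPath x k).2) :=
  Prod.ext (Fin.ext (hopPath_val_fst x k.2.le)) rfl

theorem hopPath_succ (x : Fin N → Fin 2) (k : Fin N) :
    hopPath x (k + 1) = (k.succ, (hopPath x k).2 + x k) := by
  refine Prod.ext (Fin.ext (hopPath_val_fst x k.2)) ?_
  have h : ∀ i : Fin N, (if i.val < k.val + 1 then x i else 0) =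
      (if i.val < k.val then x i else 0) + if k = i then x i else 0 := by
    intro i
    rcases lt_trichotomy i.val k.val with h | h | h
    · have : k ≠ i := fun e => by subst e; exact lt_irrefl _ h
      simp [h, this, Nat.lt_succ_of_lt h]
    · obtain rfl := Fin.ext h
      simp
    · have : k ≠ i := fun e => by subst e; exact lt_irrefl _ h
      rw [if_neg (by omega), if_neg (by omega), if_neg this, add_zero]
  simp only [hopPath, h, Finset.sum_add_distrib, Finset.sum_ite_eq, Finset.mem_univ, if_true]

theorem evolution_hopOperator (x : Fin N → Fin 2) (t : ℝ) :
    evolution (lindbladian (hopOperator x)) t (single (0, 0) (0, 0) 1) =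
      birthState (1 / 2) (fun k => single (hopPath x k) (hopPath x k) (1 : ℂ)) N t := by
  have h := evolution_eq_birthState (𝓛 := lindbladian (hopOperator x)) (r := 1 / 2)
    (E := fun k => single (hopPath x k) (hopPath x k) (1 : ℂ)) (n := N) ?_ ?_ t
  · simpa only [hopPath_zero] using h
  · intro k hk
    have h1 := hopPath_val x ⟨k, hk⟩
    have h2 := hopPath_succ x ⟨k, hk⟩
    simp only at h1 h2 ⊢
    rw [h2, h1, lindbladian_hopOperator_castSucc]
    ext p q
    simp
  · simp only [hopPath_self]
    exact lindbladian_hopOperator_last x _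

/-- The probability that the evolution ends at the last site with second register `a`. -/
theorem evolution_hopOperator_last (x : Fin N → Fin 2) (t : ℝ) (a : Fin 2) :
    evolution (lindbladian (hopOperator x)) t (single (0, 0) (0, 0) 1) (Fin.last N, a)
      (Fin.last N, a) = if ∑ i, x i = a then
        ((1 - ∑ k ∈ Finset.range N, birthWeight (1 / 2) k t : ℝ) : ℂ) else 0 := by
  rw [evolution_hopOperator, birthState, Matrix.add_apply, Matrix.sum_apply, Finset.sum_eq_zero,
    zero_add, hopPath_self, Matrix.smul_apply, Matrix.single_apply]
  · simp [Prod.ext_iff]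
  · intro k hk
    have hk := Finset.mem_range.1 hk
    have : hopPath x k ≠ (Fin.last N, a) := fun e => by
      have := hopPath_val_fst x hk.le
      rw [e] at this
      exact hk.ne' this
    simp [this]

end Hop

/-! ### Simulating the hopping process computes the parity of the hidden bits -/

/-- If each answer of the black box depends on at most `d` hidden bits, simulating the hopping
process for time `4 N` within precision `1 / 8` takes at least `N / (2 d)` queries. -/
theorem le_queries_of_simulates {N : ℕ} (hN : 0 < N) {Q : Type} [Fintype Q] [DecidableEq Q]
    {b d : ℕ} (𝒜 : QueryAlgorithm (Fin (N + 1) × Fin 2) Q b) (F : (Fin N → Fin 2) → Q → Bits b)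
    (hF : ∀ q, ∃ A : Finset (Fin N), A.card ≤ d ∧ ∀ x y, (∀ i ∈ A, x i = y i) → F x q = F y q)
    (hsim : ∀ x, 𝒜.Simulates (F x) (lindbladian (hopOperator x)) (4 * N) (1 / 8)) :
    N ≤ 2 * d * 𝒜.queries := by
  -- Only the probability of ending in `|N, 0⟩` is used: near `1` for even parity, near `0` for odd.
  have : Nonempty (Fin N) := ⟨⟨0, hN⟩⟩
  have hclose : ∀ x, |(𝒜.channel (F x) (single (0, 0) (0, 0) 1) (Fin.last N, 0) (Fin.last N, 0)).re -
      (if ∑ i, x i = 0 then 1 - ∑ k ∈ Finset.range N, birthWeight (1 / 2) k (4 * N) else 0)| ≤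
        1 / 8 := by
    intro x
    have h := norm_apply_le_of_diamondNorm_le (by norm_num) (hsim x) (0, 0) (Fin.last N, 0)
    rw [LinearMap.sub_apply, Matrix.sub_apply, evolution_hopOperator_last] at h
    refine le_trans (le_of_eq ?_) ((Complex.abs_re_le_norm _).trans h)
    rw [Complex.sub_re]
    congr 2
    split_ifs <;> simp
  -- The even case exceeds the threshold `1 / 8`, since `1 - 3 / 4 - 1 / 8 = 1 / 8` is a strict bound.
  have hw := sum_birthWeight_lt hN
  have h := 𝒜.card_le_of_parity_separation F hF (single (0, 0) (0, 0) 1) (Fin.last N, 0)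
    (Fin.last N, 0) (1 / 8) ?_ ?_
  · simpa using h
  · intro x hx
    have h := (abs_le.1 (hclose x)).1
    rw [if_pos hx] at h
    linarith
  · intro x hx
    have h := (abs_le.1 (hclose x)).2
    rw [if_neg hx] at h
    linarith

/-- An entry of the GKS matrix is a product of two entries of the Lindblad operator, each of which
depends on a single hidden bit. -/
theorem entryBox_hopOperator_local {N b : ℕ} (enc : ℂ → Bits b)
    (q : ((Fin (N + 1) × Fin 2) × (Fin (N + 1) × Fin 2)) ×
      ((Fin (N + 1) × Fin 2) × (Fin (N + 1) × Fin 2))) :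
    ∃ A : Finset (Fin N), A.card ≤ 2 ∧ ∀ x y : Fin N → Fin 2, (∀ i ∈ A, x i = y i) →
      entryBox enc (hopOperator x) q = entryBox enc (hopOperator y) q := by
  refine ⟨Finset.univ.filter (fun k => q.1.1.1 = k.succ) ∪
    Finset.univ.filter (fun k => q.2.1.1 = k.succ), ?_, fun x y h => ?_⟩
  · refine (Finset.card_union_le _ _).trans (add_le_add (b := 1) (d := 1) ?_ ?_) <;>
    · refine Finset.card_le_one.2 fun k hk l hl => ?_
      simp only [Finset.mem_filter, Finset.mem_univ, true_and] at hk hl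
      exact Fin.succ_injective _ (hk.symm.trans hl)
  · simp only [entryBox, gksMatrix, of_apply]
    rw [hopOperator_apply_congr (x := x) (y := y) (p := q.1.1) fun k hk _ => h k (by simp [hk]),
      hopOperator_apply_congr (x := x) (y := y) (p := q.2.1) fun k hk _ => h k (by simp [hk])]

/-- All entries in a row or column of the Lindblad operator depend on a single hidden bit. -/
theorem sparseBox_hopOperator_local {N b : ℕ} (enc : Set ((Fin (N + 1) × Fin 2) × ℂ) → Bits b)
    (q : (Fin (N + 1) × Fin 2) ⊕ (Fin (N + 1) × Fin 2)) :
    ∃ A : Finset (Fin N), A.card ≤ 1 ∧ ∀ x y : Fin N → Fin 2, (∀ i ∈ A, x i = y i) →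
      sparseBox enc (hopOperator x) q = sparseBox enc (hopOperator y) q := by
  rcases q with p | p
  · refine ⟨Finset.univ.filter fun k => p.1 = k.succ, ?_, fun x y h => ?_⟩
    · refine Finset.card_le_one.2 fun k hk l hl => ?_
      simp only [Finset.mem_filter, Finset.mem_univ, true_and] at hk hl
      exact Fin.succ_injective _ (hk.symm.trans hl)
    · have (q : Fin (N + 1) × Fin 2) : hopOperator x p q = hopOperator y p q :=
        hopOperator_apply_congr fun k hk _ => h k (by simp [hk])
      simp only [sparseBox, this]
  · refine ⟨Finset.univ.filter fun k => p.1 = k.castSucc, ?_, fun x y h => ?_⟩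
    · refine Finset.card_le_one.2 fun k hk l hl => ?_
      simp only [Finset.mem_filter, Finset.mem_univ, true_and] at hk hl
      exact Fin.castSucc_injective _ (hk.symm.trans hl)
    · have (q : Fin (N + 1) × Fin 2) : hopOperator x q p = hopOperator y q p :=
        hopOperator_apply_congr fun k _ hk => h k (by simp [hk])
      simp only [sparseBox, this]

theorem mainTheorem3 (N : ℕ) (hN : 7 ≤ N) :
    ∃ 𝓕 : Set (Matrix (Fin (N + 1) × Fin 2) (Fin (N + 1) × Fin 2) ℂ),
      𝓕.Nonempty ∧
      (∀ L ∈ 𝓕, IsOneSparse L ∧ diamondNorm (lindbladian L) = 1) ∧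
      (∀ (b : ℕ) (enc : ℂ → Bits b)
        (𝒜 : QueryAlgorithm (Fin (N + 1) × Fin 2)
          (((Fin (N + 1) × Fin 2) × (Fin (N + 1) × Fin 2)) ×
            ((Fin (N + 1) × Fin 2) × (Fin (N + 1) × Fin 2))) b),
        (∀ L ∈ 𝓕, 𝒜.Simulates (entryBox enc L) (lindbladian L) (4 * N) (1 / 8)) →
          (N : ℝ) / 4 ≤ 𝒜.queries) ∧
      (∀ (b : ℕ) (enc : Set ((Fin (N + 1) × Fin 2) × ℂ) → Bits b)
        (𝒜 : QueryAlgorithm (Fin (N + 1) × Fin 2)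
          ((Fin (N + 1) × Fin 2) ⊕ (Fin (N + 1) × Fin 2)) b),
        (∀ L ∈ 𝓕, 𝒜.Simulates (sparseBox enc L) (lindbladian L) (4 * N) (1 / 8)) →
          (N : ℝ) / 2 ≤ 𝒜.queries) := by
  have hN' : 0 < N := by omega
  refine ⟨Set.range hopOperator, Set.range_nonempty _, ?_, ?_, ?_⟩
  · rintro _ ⟨x, rfl⟩
    exact ⟨isOneSparse_hopOperator x, diamondNorm_lindbladian_hopOperator hN' x⟩
  · intro b enc 𝒜 h
    have h := le_queries_of_simulates hN' 𝒜 (fun x => entryBox enc (hopOperator x))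
      (entryBox_hopOperator_local enc) fun x => h _ ⟨x, rfl⟩
    have h' : (N : ℝ) ≤ 2 * 2 * 𝒜.queries := by exact_mod_cast h
    linarith
  · intro b enc 𝒜 h
    have h := le_queries_of_simulates hN' 𝒜 (fun x => sparseBox enc (hopOperator x))
      (sparseBox_hopOperator_local enc) fun x => h _ ⟨x, rfl⟩
    have h' : (N : ℝ) ≤ 2 * 1 * 𝒜.queries := by exact_mod_cast h
    linarith
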